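/- Let $L\ge 1$ and $S\ge 0$ be integers and let $\beta>0$ be the positive solution of $L\beta+S\beta^2=1$. Put $n=L+S$, and partition $[0,1)$ from left to right into intervals $I_1,\dots,I_n$, closed on the left and open on the right, where $I_1,\dots,I_L$ have length $\beta$ and $I_{L+1},\dots,I_{L+S}$ have length $\beta^2$. For $S\ge 1$ let $\rho$ be the permutation of $\{1,\dots,n\}$ with $$\rho(i)=i+1\ (1\le i\le L-1),\qquad \rho(L)=L+S,\qquad \rho(L+1)=1,\qquad \rho(i)=i-1\ (L+2\le i\le L+S);$$ for $S=0$ let $\rho$ be any permutation of $\{1,\dots,L\}$. Let $f_{L,S}:[0,1)\to[0,1)$ be the interval exchange transformation which translates each $I_j$ in such a way that the images of the intervals, read from left to right, are those of $I_{\rho(1)},I_{\rho(2)},\dots,I_{\rho(n)}$. For a sequence $(x_i)_{i\ge 0}$ in $[0,1)$ let $$D_N^*=\sup_{0\le a\le 1}\left|\frac{\#\{0\le i<N: x_i\in[0,a)\}}{N}-a\right| ,$$ and call the sequence a low-discrepancy sequence if $D_N^*=O(N^{-1}\log N)$ as $N\to\infty$. Then the sequence $(f_{L,S}^i(x_0))_{i\ge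 0}$ is a low-discrepancy sequence for all $x_0\in[0,1)$ if and only if $\beta$ is irrational. -/

import Mathlib

open scoped Asymptotics

noncomputable section

/-- Left end point of the interval `I_i` before the exchange: the intervals `I_0, I_1, …` have
lengths `lam 0, lam 1, …` and are laid out from left to right in their natural order. -/
def ietLeft {n : ℕ} (lam : Fin n → ℝ) (i : Fin n) : ℝ :=
  ∑ j ∈ Finset.univ.filter (fun j => j < i), lam j

/-- Left end point of the interval `I_i` after the exchange, where the `k`-th interval from the
left is then `I_(ρ k)`; thus `ρ.symm i` is the new place of `I_i`. -/
def ietNewLeft {n : ℕ} (lam : Fin n → ℝ) (ρ : Equiv.Perm (Fin n)) (i : Fin n) : ℝ :=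
  ∑ j ∈ Finset.univ.filter (fun j => ρ.symm j < ρ.symm i), lam j

/-- The interval exchange transformation with length data `lam`, for which `ρ` lists the order of
the intervals after the exchange. It translates each `I_i` to its new place.
(Total on `ℝ`, with the irrelevant value `0` off the union of the `I_i`, which is `[0, 1)` when
the lengths sum to `1`.) -/
def iet {n : ℕ} (lam : Fin n → ℝ) (ρ : Equiv.Perm (Fin n)) (x : ℝ) : ℝ :=
  ∑ i, (Set.Ico (ietLeft lam i) (ietLeft lam i + lam i)).indicator
    (fun y => y + (ietNewLeft lam ρ i - ietLeft lam i)) x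

/-- The length data of `f_{L,S}`: `L` intervals of length `β`, then `S` of length `β ^ 2`. -/
def lsLength (L S : ℕ) (β : ℝ) (i : Fin (L + S)) : ℝ :=
  if (i : ℕ) < L then β else β ^ 2

/-- `ρ` is the permutation of `f_{L,S}`. In terms of `i = k + 1 ∈ {1, …, L + S}`, for `S ≥ 1`:
`ρ(i) = i + 1` for `1 ≤ i ≤ L - 1`, `ρ(L) = L + S`, `ρ(L + 1) = 1`, and
`ρ(i) = i - 1` for `L + 2 ≤ i ≤ L + S`.
For `S = 0` these formulas do not determine a permutation and every permutation is allowed. -/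
def IsLSPerm (L S : ℕ) (ρ : Equiv.Perm (Fin (L + S))) : Prop :=
  1 ≤ S → ∀ k : Fin (L + S),
    ((k : ℕ) + 1 ≤ L - 1 → (ρ k : ℕ) + 1 = ((k : ℕ) + 1) + 1) ∧
    ((k : ℕ) + 1 = L → (ρ k : ℕ) + 1 = L + S) ∧
    ((k : ℕ) + 1 = L + 1 → (ρ k : ℕ) + 1 = 1) ∧
    (L + 2 ≤ (k : ℕ) + 1 → (ρ k : ℕ) + 1 = ((k : ℕ) + 1) - 1)

/-- The permutation of `f_{L,S}` exists. -/
theorem exists_isLSPerm (L S : ℕ) (hL : 1 ≤ L) : ∃ ρ : Equiv.Perm (Fin (L + S)), IsLSPerm L S ρ := by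
  rcases Nat.eq_zero_or_pos S with hS | hS
  · exact ⟨1, fun h => by omega⟩
  · let g : Fin (L + S) → Fin (L + S) := fun k =>
      ⟨if (k : ℕ) + 1 < L then k + 1 else if (k : ℕ) + 1 = L then L + S - 1 else
        if (k : ℕ) = L then 0 else k - 1, by have := k.2; split_ifs <;> omega⟩
    have hg : Function.Injective g := by
      intro a b hab
      have h := congrArg Fin.val hab
      have ha := a.2
      have hb := b.2
      simp only [g] at h
      apply Fin.ext
      split_ifs at h <;> omega
    refine ⟨Equiv.ofBijective g (Finite.injective_iff_bijective.mp hg), fun _ k => ?_⟩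
    have hk := k.2
    simp only [Equiv.ofBijective_apply, g]
    refine ⟨fun h => ?_, fun h => ?_, fun h => ?_, fun h => ?_⟩ <;> split_ifs <;> omega

/-- The star-discrepancy `D_N^*` of the first `N` points `x 0, …, x (N - 1)` of a sequence
in `[0, 1)`; points are counted with multiplicity. -/
def starDiscrepancy (x : ℕ → ℝ) (N : ℕ) : ℝ :=
  ⨆ a : Set.Icc (0 : ℝ) 1,
    |(((Finset.range N).filter (fun i => 0 ≤ x i ∧ x i < (a : ℝ))).card : ℝ) / (N : ℝ) - (a : ℝ)|

/-- `x` is a low-discrepancy sequence: `D_N^* = O(N⁻¹ log N)` as `N → ∞`. -/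
def IsLowDiscrepancy (x : ℕ → ℝ) : Prop :=
  (fun N : ℕ => starDiscrepancy x N) =O[Filter.atTop] (fun N : ℕ => (N : ℝ)⁻¹ * Real.log N)

end

/-!
If `β` is rational, all translation lengths lie in a lattice `δ ℤ`. The orbit of `0` then stays in
this lattice and never meets `(0, δ)`, so its discrepancy does not tend to `0`
(`not_isLowDiscrepancy_of_lattice`).

If `β` is irrational, then `S ≥ 1`, and `f_{L,S}` is a tower over a rotation. It maps `I_{k+1}` onto
`I_k` for `1 ≤ k < L` and `I_{L+i}` onto `I_{L+i+1}` for `1 ≤ i < S`; it maps `I_1` onto the right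
part of `I_L` together with `I_{L+1}`, and `I_{L+S}` onto the left part of `I_L`, which has length
`β ^ 2`. Hence the first return map to `I_L` is, up to scaling by `β`, the rotation `u ↦ u + β` of
`[0, 1)`, with return time `L` for `u < 1 - β` and `L + S` otherwise
(`IsLSExchange.iterate_returnTime`), and every point lies in the tower.

Consequently the number of visits to `[0, a)`, minus its expected value, is up to `O(1)` a Birkhoff
sum over this rotation of a fixed combination of boundedly many indicators of intervals `[0, t)`
(`IsLSExchange.visitDeviation_returnTime`), and this combination has mean `0`. So everything reduces
to the bound `O(log m)`, uniform in the starting point and in `t`, for the discrepancy of `m` points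
of the rotation by `β` (`exists_rotation_discrepancy_le`). For this, `q` consecutive points are
within `1 / q` of a translated lattice `ℤ / q` modulo `1` if `|β - p / q| ≤ 1 / q ^ 2`, so a block of
length `q` contributes `O(1)`. Since `β` is a root of a quadratic polynomial, it is badly
approximable, and Dirichlet's theorem gives such a `q ≤ m` with `q ≥ (m + 1) / M`; splitting off
blocks in this way uses up `m` points after `O(log m)` steps.
-/

/-! ### Rotations by quadratic irrationals -/

/-- Turns the counting of points modulo `1` into sums of floors, which are monotone in `y`. -/
theorem ite_fract_lt_eq_floor_sub_floor (y t : ℝ) (h0 : 0 ≤ t) (h1 : t ≤ 1) :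
    (if Int.fract y < t then (1 : ℝ) else 0) = (⌊y⌋ : ℝ) - (⌊y - t⌋ : ℝ) := by
  have hy := Int.floor_add_fract y
  have h2 := Int.fract_nonneg y
  have h3 := Int.fract_lt_one y
  split_ifs with h
  · have : ⌊y - t⌋ = ⌊y⌋ - 1 := by
      rw [Int.floor_eq_iff]; push_cast; constructor <;> linarith
    rw [this]; push_cast; ring
  · have : ⌊y - t⌋ = ⌊y⌋ := by
      rw [Int.floor_eq_iff]; constructor <;> linarith
    rw [this]; ring

theorem sum_emod_eq_sum_range (p m : ℤ) (q : ℕ) (hq : 0 < q) (hpq : IsCoprime p (q : ℤ)) :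
    ∑ j ∈ Finset.range q, (m + j * p) % (q : ℤ) = ∑ j ∈ Finset.range q, (j : ℤ) := by
  have hq' : (0 : ℤ) < q := by exact_mod_cast hq
  have hmaps : ∀ j ∈ Finset.range q, ((m + j * p) % (q : ℤ)).toNat ∈ Finset.range q := by
    intro j _
    have h1 := Int.emod_nonneg (m + j * p) hq'.ne'
    have h2 := Int.emod_lt_of_pos (m + j * p) hq'
    rw [Finset.mem_range]; omega
  have hinj : Set.InjOn (fun j : ℕ => ((m + j * p) % (q : ℤ)).toNat) (Finset.range q) := by
    intro i hi j hj hij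
    simp only [Finset.coe_range, Set.mem_Iio] at hi hj
    have h1 := Int.emod_nonneg (m + i * p) hq'.ne'
    have h2 := Int.emod_nonneg (m + j * p) hq'.ne'
    have h3 : (m + i * p) % (q : ℤ) = (m + j * p) % (q : ℤ) := by
      simp only at hij; omega
    have h4 : (q : ℤ) ∣ ((j : ℤ) - i) * p := by
      have := Int.ModEq.dvd h3
      convert this using 1; ring
    have h5 : (q : ℤ) ∣ (j : ℤ) - i := hpq.symm.dvd_of_dvd_mul_right h4
    have h6 : (j : ℤ) - i = 0 := by
      apply Int.eq_zero_of_abs_lt_dvd h5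
      rw [abs_lt]; constructor <;> omega
    omega
  refine Finset.sum_nbij (fun j : ℕ => ((m + j * p) % (q : ℤ)).toNat) hmaps hinj
    (Finset.surjOn_of_injOn_of_card_le _ hmaps hinj le_rfl) ?_
  intro j _
  rw [Int.toNat_of_nonneg (Int.emod_nonneg _ hq'.ne')]

/-- A form of Hermite's identity: the sum of `⌊w + j p / q⌋` over a full period depends on `w`
only through the summand `⌊q w⌋`. -/
theorem exists_sum_floor_add_mul_div (p : ℤ) (q : ℕ) (hq : 0 < q) (hpq : IsCoprime p (q : ℤ)) :
    ∃ c : ℤ, ∀ w : ℝ, ∑ j ∈ Finset.range q, ⌊w + j * ((p : ℝ) / q)⌋ = ⌊q * w⌋ + c := by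
  have hq' : (0 : ℤ) < q := by exact_mod_cast hq
  have hqr : (0 : ℝ) < q := by exact_mod_cast hq
  have key : ∀ w : ℝ, (q : ℤ) * ∑ j ∈ Finset.range q, ⌊w + j * ((p : ℝ) / q)⌋ =
      q * ⌊q * w⌋ + (∑ j ∈ Finset.range q, (j : ℤ) * p - ∑ j ∈ Finset.range q, (j : ℤ)) := by
    intro w
    have h1 : ∀ j : ℕ, ⌊w + j * ((p : ℝ) / q)⌋ = (⌊q * w⌋ + j * p) / (q : ℤ) := by
      intro j
      have h2 : w + j * ((p : ℝ) / q) = (q * w + ((j * p : ℤ) : ℝ)) / (q : ℕ) := by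
        push_cast; field_simp
      rw [h2, Int.floor_div_natCast, Int.floor_add_intCast]
    rw [← sum_emod_eq_sum_range p ⌊q * w⌋ q hq hpq, Finset.mul_sum]
    have h3 : (q : ℤ) * ⌊q * w⌋ = ∑ j ∈ Finset.range q, ⌊(q : ℝ) * w⌋ := by simp
    rw [h3, ← Finset.sum_sub_distrib, ← Finset.sum_add_distrib]
    refine Finset.sum_congr rfl fun j _ => ?_
    rw [h1]
    have := Int.mul_ediv_add_emod (⌊(q : ℝ) * w⌋ + j * p) q
    linarith
  refine ⟨∑ j ∈ Finset.range q, ⌊(0 : ℝ) + j * ((p : ℝ) / q)⌋, fun w => ?_⟩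
  have h1 := key w
  have h2 := key 0
  simp only [mul_zero, Int.floor_zero] at h2
  apply mul_left_cancel₀ hq'.ne'
  rw [h1, mul_add, h2]; ring

/-- A block of `q` consecutive points of a rotation, where `q` is the denominator of a good
rational approximation to the angle, has bounded discrepancy. -/
theorem abs_sum_rotation_block_le (β : ℝ) (p : ℤ) (q : ℕ) (hq : 0 < q)
    (hpq : IsCoprime p (q : ℤ)) (happ : |β - p / q| * q ^ 2 ≤ 1) (u t : ℝ) (h0 : 0 ≤ t)
    (h1 : t ≤ 1) :
    |∑ j ∈ Finset.range q, (if Int.fract (u + j * β) < t then (1 : ℝ) else 0) - q * t| ≤ 4 := by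
  obtain ⟨c, hc⟩ := exists_sum_floor_add_mul_div p q hq hpq
  have hqr : (0 : ℝ) < q := by exact_mod_cast hq
  have hd : ∀ j ∈ Finset.range q, |j * (β - p / q)| ≤ 1 / q := by
    intro j hj
    have hj' : (j : ℝ) ≤ q := by exact_mod_cast (Finset.mem_range.mp hj).le
    rw [abs_mul, abs_of_nonneg (Nat.cast_nonneg j), le_div_iff₀ hqr]
    calc (j : ℝ) * |β - p / q| * q ≤ q * |β - p / q| * q := by gcongr
      _ = |β - p / q| * q ^ 2 := by ring
      _ ≤ 1 := happ
  have hG : ∀ v : ℝ, |∑ j ∈ Finset.range q, (⌊v + j * β⌋ : ℝ) - q * v - c| ≤ 2 := by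
    intro v
    have hup : ∑ j ∈ Finset.range q, ⌊v + j * β⌋ ≤ ⌊q * (v + 1 / q)⌋ + c := by
      rw [← hc]
      refine Finset.sum_le_sum fun j hj => Int.floor_le_floor ?_
      have := (abs_le.mp (hd j hj)).2
      linarith
    have hlo : ⌊q * (v - 1 / q)⌋ + c ≤ ∑ j ∈ Finset.range q, ⌊v + j * β⌋ := by
      rw [← hc]
      refine Finset.sum_le_sum fun j hj => Int.floor_le_floor ?_
      have := (abs_le.mp (hd j hj)).1
      linarith
    have e1 : (q : ℝ) * (v + 1 / q) = q * v + 1 := by field_simp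
    have e2 : (q : ℝ) * (v - 1 / q) = q * v - 1 := by field_simp
    rw [e1] at hup
    rw [e2] at hlo
    have hup' : ∑ j ∈ Finset.range q, (⌊v + j * β⌋ : ℝ) ≤ (⌊q * v + 1⌋ : ℝ) + c := by
      exact_mod_cast hup
    have hlo' : (⌊q * v - 1⌋ : ℝ) + c ≤ ∑ j ∈ Finset.range q, (⌊v + j * β⌋ : ℝ) := by
      exact_mod_cast hlo
    have := Int.floor_le (q * v + 1)
    have := Int.lt_floor_add_one (q * v - 1)
    rw [abs_le]; constructor <;> linarith
  have hsum : ∑ j ∈ Finset.range q, (if Int.fract (u + j * β) < t then (1 : ℝ) else 0) =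
      ∑ j ∈ Finset.range q, (⌊u + j * β⌋ : ℝ) -
        ∑ j ∈ Finset.range q, (⌊(u - t) + j * β⌋ : ℝ) := by
    rw [← Finset.sum_sub_distrib]
    refine Finset.sum_congr rfl fun j _ => ?_
    rw [ite_fract_lt_eq_floor_sub_floor _ _ h0 h1]
    congr 3; ring
  have a1 := abs_le.mp (hG u)
  have a2 := abs_le.mp (hG (u - t))
  rw [hsum, abs_le]
  constructor <;> linarith [a1.1, a1.2, a2.1, a2.2]

/-- Liouville's inequality for a quadratic irrational: it is badly approximable. -/
theorem exists_badly_approximable (L S : ℕ) (β : ℝ) (hβ : 0 < β)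
    (hβ1 : (L : ℝ) * β + (S : ℝ) * β ^ 2 = 1) (hirr : Irrational β) :
    ∃ M : ℝ, 1 < M ∧ ∀ r : ℚ, |β - r| ≤ 1 → 1 ≤ M * |β - r| * (r.den : ℝ) ^ 2 := by
  have hM : (0 : ℝ) ≤ S * (2 * β + 1) + L := by positivity
  refine ⟨S * (2 * β + 1) + L + 2, by linarith, fun r hr => ?_⟩
  have hden : (0 : ℝ) < r.den := by exact_mod_cast r.den_pos
  set z : ℤ := L * r.num * r.den + S * r.num ^ 2 - (r.den : ℤ) ^ 2 with hz
  have hrr : (r : ℝ) * r.den = r.num := by exact_mod_cast Rat.mul_den_eq_num r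
  have hzr : (z : ℝ) = ((r : ℝ) - β) * (S * (r + β) + L) * (r.den : ℝ) ^ 2 := by
    rw [hz]; push_cast; rw [← hrr]
    linear_combination (r.den : ℝ) ^ 2 * hβ1
  have hne : z ≠ 0 := by
    intro h0
    rw [h0, Int.cast_zero, eq_comm, mul_eq_zero, mul_eq_zero] at hzr
    have hS : S ≠ 0 := by
      rintro rfl
      refine hirr ⟨1 / L, ?_⟩
      have : (L : ℝ) ≠ 0 := by rintro h; simp [h] at hβ1
      push_cast
      field_simp
      simpa [mul_comm] using hβ1.symm
    have hSr : (S : ℝ) ≠ 0 := by exact_mod_cast hS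
    rcases hzr with (h | h) | h
    · exact hirr ⟨r, by linarith⟩
    · refine hirr ⟨-L / S - r, ?_⟩
      push_cast
      field_simp
      linarith
    · exact absurd h (by positivity)
  have h1 : (1 : ℝ) ≤ |(z : ℝ)| := by exact_mod_cast Int.one_le_abs hne
  rw [hzr, abs_mul, abs_mul, abs_of_nonneg (by positivity : (0 : ℝ) ≤ (r.den : ℝ) ^ 2),
    abs_sub_comm] at h1
  have h2 : |(S : ℝ) * (r + β) + L| ≤ S * (2 * β + 1) + L + 2 := by
    have h3 := abs_le.mp hr
    have hS0 : (0 : ℝ) ≤ S := Nat.cast_nonneg S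
    have hL0 : (0 : ℝ) ≤ L := Nat.cast_nonneg L
    rw [abs_le]
    constructor <;> nlinarith
  calc (1 : ℝ) ≤ |β - r| * |(S : ℝ) * (r + β) + L| * (r.den : ℝ) ^ 2 := h1
    _ ≤ |β - r| * (S * (2 * β + 1) + L + 2) * (r.den : ℝ) ^ 2 := by gcongr
    _ = _ := by ring

/-- Orbits of the rotation by `β` have discrepancy `O(log m)`, uniformly in the starting point:
Dirichlet's theorem and bad approximability give a denominator `q ≤ m` of a good approximation
which is at least a fixed fraction of `m`; one splits off a block of length `q` and iterates. -/
theorem exists_rotation_discrepancy_le (L S : ℕ) (β : ℝ) (hβ : 0 < β)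
    (hβ1 : (L : ℝ) * β + (S : ℝ) * β ^ 2 = 1) (hirr : Irrational β) :
    ∃ K : ℝ, 0 ≤ K ∧ ∀ (m : ℕ) (u t : ℝ), 0 ≤ t → t ≤ 1 →
      |∑ j ∈ Finset.range m, (if Int.fract (u + j * β) < t then (1 : ℝ) else 0) - m * t|
        ≤ K * Real.log (1 + m) := by
  obtain ⟨M, hM1, hM⟩ := exists_badly_approximable L S β hβ hβ1 hirr
  have hM0 : 0 < M := by linarith
  have hc1 : 0 < 1 - 1 / M := by
    have : 1 / M < 1 := by rw [div_lt_one hM0]; exact hM1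
    linarith
  have hlog : Real.log (1 - 1 / M) < 0 :=
    Real.log_neg hc1 (by have : 0 < 1 / M := by positivity
                         linarith)
  have hK : 0 ≤ 4 / -Real.log (1 - 1 / M) := div_nonneg (by norm_num) (by linarith)
  -- Each block costs `4` and shrinks `1 + m` by the factor `1 - 1 / M`.
  refine ⟨4 / -Real.log (1 - 1 / M), hK, fun m => ?_⟩
  induction m using Nat.strong_induction_on with
  | _ m ih =>
  intro u t h0 h1
  rcases Nat.eq_zero_or_pos m with rfl | hm
  · simp
  obtain ⟨r, hr1, hr2⟩ := Real.exists_rat_abs_sub_le_and_den_le β hm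
  have hden : 0 < r.den := r.den_pos
  have hdr : (0 : ℝ) < r.den := by exact_mod_cast hden
  have hdr1 : (1 : ℝ) ≤ r.den := by exact_mod_cast hden
  have hdm : (r.den : ℝ) ≤ m := by exact_mod_cast hr2
  have hm0 : (0 : ℝ) < m := by exact_mod_cast hm
  rw [le_div_iff₀ (by positivity)] at hr1
  have hrr : (r : ℝ) = (r.num : ℝ) / r.den := by exact_mod_cast (Rat.num_div_den r).symm
  have habs := abs_nonneg (β - r)
  have hle1 : |β - r| ≤ 1 := by
    refine le_trans ?_ hr1
    apply le_mul_of_one_le_right habs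
    nlinarith
  have hbig : (m : ℝ) + 1 ≤ M * r.den := by
    have h2 := hM r hle1
    have h3 : ((m : ℝ) + 1) * 1 ≤ (m + 1) * (M * |β - r| * (r.den : ℝ) ^ 2) := by gcongr
    calc (m : ℝ) + 1 ≤ (m + 1) * (M * |β - r| * (r.den : ℝ) ^ 2) := by linarith
      _ = (M * r.den) * (|β - r| * ((m + 1) * r.den)) := by ring
      _ ≤ (M * r.den) * 1 := by gcongr
      _ = _ := by ring
  have hcop : IsCoprime r.num (r.den : ℤ) := by
    rw [Int.isCoprime_iff_gcd_eq_one]; exact r.reduced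
  have hblock := abs_sum_rotation_block_le β r.num r.den hden hcop (by
    rw [← hrr]
    refine le_trans ?_ hr1
    gcongr
    nlinarith) u t h0 h1
  have hrest := ih (m - r.den) (by omega) (u + r.den * β) t h0 h1
  have hsplit : ∑ j ∈ Finset.range m, (if Int.fract (u + j * β) < t then (1 : ℝ) else 0) =
      ∑ j ∈ Finset.range r.den, (if Int.fract (u + j * β) < t then (1 : ℝ) else 0) +
      ∑ j ∈ Finset.range (m - r.den),
        (if Int.fract (u + r.den * β + j * β) < t then (1 : ℝ) else 0) := by
    conv_lhs => rw [← Nat.add_sub_cancel' hr2, Finset.sum_range_add]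
    congr 1
    refine Finset.sum_congr rfl fun j _ => ?_
    push_cast
    rw [add_mul, ← add_assoc]
  rw [Nat.cast_sub hr2] at hrest
  have hlogle : Real.log (1 + ((m : ℝ) - r.den)) ≤
      Real.log (1 - 1 / M) + Real.log (1 + m) := by
    rw [← Real.log_mul hc1.ne' (by positivity)]
    apply Real.log_le_log (by linarith)
    have : (1 + (m : ℝ)) / M ≤ r.den := by rw [div_le_iff₀ hM0]; linarith
    calc 1 + ((m : ℝ) - r.den) ≤ (1 + m) - (1 + m) / M := by linarith
      _ = _ := by ring
  have hKlog := mul_le_mul_of_nonneg_left hlogle hK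
  have hK4 : 4 / -Real.log (1 - 1 / M) * Real.log (1 - 1 / M) = -4 := by
    rw [div_neg, neg_mul, div_mul_cancel₀ _ hlog.ne]
  rw [mul_add, hK4] at hKlog
  rw [hsplit, abs_le]
  rw [abs_le] at hblock hrest
  constructor <;> linarith [hblock.1, hblock.2, hrest.1, hrest.2]

/-! ### The branches of `f_{L,S}` -/

theorem sum_filter_lt_eq_sum_range {n : ℕ} (g : ℕ → ℝ) (i : Fin n) :
    ∑ j ∈ Finset.univ.filter (fun j : Fin n => j < i), g j = ∑ k ∈ Finset.range i, g k := by
  refine Finset.sum_bij (fun j _ => (j : ℕ)) ?_ ?_ ?_ ?_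
  · intro j hj; simpa using hj
  · intro a _ b _ h; exact Fin.ext h
  · intro k hk
    have hk' := Finset.mem_range.mp hk
    exact ⟨⟨k, hk'.trans i.2⟩, Finset.mem_filter.mpr ⟨Finset.mem_univ _, hk'⟩, rfl⟩
  · intro _ _; rfl

theorem ietLeft_add_le {n : ℕ} (lam : Fin n → ℝ) (h : ∀ i, 0 ≤ lam i) {i j : Fin n}
    (hij : i < j) : ietLeft lam i + lam i ≤ ietLeft lam j := by
  unfold ietLeft
  rw [add_comm, ← Finset.sum_insert (s := Finset.univ.filter (fun k => k < i)) (by simp)]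
  refine Finset.sum_le_sum_of_subset_of_nonneg ?_ fun k _ _ => h k
  intro k hk
  simp only [Finset.mem_insert, Finset.mem_filter, Finset.mem_univ, true_and] at hk ⊢
  rcases hk with rfl | hk
  · exact hij
  · exact hk.trans hij

theorem iet_eq_of_mem {n : ℕ} (lam : Fin n → ℝ) (h : ∀ i, 0 ≤ lam i) (ρ : Equiv.Perm (Fin n))
    (i : Fin n) (x : ℝ) (h1 : ietLeft lam i ≤ x) (h2 : x < ietLeft lam i + lam i) :
    iet lam ρ x = x + (ietNewLeft lam ρ i - ietLeft lam i) := by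
  unfold iet
  rw [Finset.sum_eq_single i]
  · rw [Set.indicator_of_mem (Set.mem_Ico.mpr ⟨h1, h2⟩)]
  · intro j _ hj
    apply Set.indicator_of_notMem
    rintro ⟨h3, h4⟩
    rcases lt_or_gt_of_ne hj with hlt | hlt
    · linarith [ietLeft_add_le lam h hlt]
    · linarith [ietLeft_add_le lam h hlt]
  · simp

theorem ietNewLeft_eq_sum {n : ℕ} (lam : Fin n → ℝ) (ρ : Equiv.Perm (Fin n)) (k : Fin n) :
    ietNewLeft lam ρ (ρ k) = ∑ j ∈ Finset.univ.filter (fun j : Fin n => j < k), lam (ρ j) := by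
  unfold ietNewLeft
  symm
  refine Finset.sum_bij (fun j _ => ρ j) ?_ ?_ ?_ ?_
  · intro j hj; simpa using hj
  · intro a _ b _ h; exact ρ.injective h
  · intro j hj; exact ⟨ρ.symm j, by simpa using hj, by simp⟩
  · intro _ _; rfl

theorem sum_range_ite_lt (L k : ℕ) (a b : ℝ) :
    ∑ j ∈ Finset.range k, (if j < L then a else b) =
      (min k L : ℕ) * a + (k - L : ℕ) * b := by
  induction k with
  | zero => simp
  | succ k ih =>
    rw [Finset.sum_range_succ, ih]
    split_ifs with h
    · rw [min_eq_left h.le, min_eq_left (Nat.succ_le_of_lt h), Nat.sub_eq_zero_of_le h.le,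
        Nat.sub_eq_zero_of_le (Nat.succ_le_of_lt h)]
      push_cast; ring
    · push Not at h
      rw [min_eq_right h, min_eq_right (h.trans k.le_succ), Nat.succ_sub h]
      push_cast; ring

theorem ietLeft_lsLength (L S : ℕ) (β : ℝ) (i : Fin (L + S)) :
    ietLeft (lsLength L S β) i = (min (i : ℕ) L : ℕ) * β + ((i : ℕ) - L : ℕ) * β ^ 2 := by
  rw [← sum_range_ite_lt]
  exact sum_filter_lt_eq_sum_range (fun j => if j < L then β else β ^ 2) i

/-- The lengths of the intervals in their new order: `L - 1` times `β`, then `β ^ 2`, `β`, and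
`β ^ 2` from there on. -/
theorem lsLength_perm {L S : ℕ} (hL : 1 ≤ L) (hS : 1 ≤ S) (β : ℝ) {ρ : Equiv.Perm (Fin (L + S))}
    (hρ : IsLSPerm L S ρ) (k : Fin (L + S)) :
    lsLength L S β (ρ k) = if (k : ℕ) = L then β else if (k : ℕ) < L - 1 then β else β ^ 2 := by
  obtain ⟨h1, h2, h3, h4⟩ := hρ hS k
  unfold lsLength
  have := k.2
  split_ifs <;> first | rfl | omega

theorem ietNewLeft_lsLength {L S : ℕ} (hL : 1 ≤ L) (hS : 1 ≤ S) (β : ℝ)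
    {ρ : Equiv.Perm (Fin (L + S))} (hρ : IsLSPerm L S ρ) (k : Fin (L + S)) :
    ietNewLeft (lsLength L S β) ρ (ρ k) =
      (min (k : ℕ) (L - 1) : ℕ) * β + ((k : ℕ) - (L - 1) : ℕ) * β ^ 2 +
        if L < (k : ℕ) then β - β ^ 2 else 0 := by
  rw [ietNewLeft_eq_sum, Finset.sum_congr rfl fun j _ => lsLength_perm hL hS β hρ j,
    sum_filter_lt_eq_sum_range
      (fun j => if j = L then β else if j < L - 1 then β else β ^ 2) k, ← sum_range_ite_lt]
  have h1 : ∀ j : ℕ, (if j = L then β else if j < L - 1 then β else β ^ 2) =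
      (if j < L - 1 then β else β ^ 2) + if j = L then β - β ^ 2 else 0 := by
    intro j
    split_ifs <;> first | omega | ring
  simp only [h1, Finset.sum_add_distrib, Finset.sum_ite_eq', Finset.mem_range]

theorem lsLength_nonneg (L S : ℕ) {β : ℝ} (hβ : 0 < β) (i : Fin (L + S)) :
    0 ≤ lsLength L S β i := by
  unfold lsLength; split_ifs <;> positivity

/-- The interval exchange `f_{L,S}` for `S ≥ 1`, piece by piece: it is a translation on `I_1`, on
`I_2 ∪ ⋯ ∪ I_L`, on `I_{L+1} ∪ ⋯ ∪ I_{L+S-1}` and on `I_{L+S}`. -/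
structure IsLSExchange (L S : ℕ) (β : ℝ) (f : ℝ → ℝ) : Prop where
  first : ∀ x, 0 ≤ x → x < β → f x = x + ((L - 1 : ℝ) * β + β ^ 2)
  long : ∀ x, β ≤ x → x < L * β → f x = x - β
  short : ∀ x, L * β ≤ x → x < 1 - β ^ 2 → f x = x + β ^ 2
  last : ∀ x, 1 - β ^ 2 ≤ x → x < 1 → f x = x - (1 - β ^ 2) + (L - 1 : ℝ) * β

theorem exists_nat_mul_le_lt {δ x : ℝ} (hδ : 0 < δ) (hx : 0 ≤ x) :
    ∃ k : ℕ, k * δ ≤ x ∧ x < (k + 1) * δ := by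
  refine ⟨⌊x / δ⌋₊, ?_, ?_⟩
  · rw [← le_div_iff₀ hδ]; exact Nat.floor_le (by positivity)
  · rw [← div_lt_iff₀ hδ]; exact Nat.lt_floor_add_one _

theorem isLSExchange_iet {L S : ℕ} (hL : 1 ≤ L) (hS : 1 ≤ S) {β : ℝ} (hβ : 0 < β)
    (hβ1 : (L : ℝ) * β + (S : ℝ) * β ^ 2 = 1) {ρ : Equiv.Perm (Fin (L + S))}
    (hρ : IsLSPerm L S ρ) : IsLSExchange L S β (iet (lsLength L S β) ρ) := by
  have hβ2 : 0 < β ^ 2 := by positivity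
  have hnn := lsLength_nonneg L S hβ
  -- The interval with index `i` is the one in new place `k`.
  have key : ∀ (k i : Fin (L + S)) (x : ℝ), ρ k = i → ietLeft (lsLength L S β) i ≤ x →
      x < ietLeft (lsLength L S β) i + lsLength L S β i →
      iet (lsLength L S β) ρ x = x + (((min (k : ℕ) (L - 1) : ℕ) * β +
        ((k : ℕ) - (L - 1) : ℕ) * β ^ 2 + if L < (k : ℕ) then β - β ^ 2 else 0) -
          ((min (i : ℕ) L : ℕ) * β + ((i : ℕ) - L : ℕ) * β ^ 2)) := by
    rintro k i x rfl hx1 hx2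
    rw [iet_eq_of_mem _ hnn ρ _ x hx1 hx2, ietNewLeft_lsLength hL hS β hρ, ietLeft_lsLength]
  simp only [ietLeft_lsLength, lsLength] at key
  have hLr : ((L - 1 : ℕ) : ℝ) = L - 1 := by rw [Nat.cast_sub hL, Nat.cast_one]
  constructor
  · intro x hx1 hx2
    have hk := (hρ hS ⟨L, by omega⟩).2.2.1 rfl
    rw [key ⟨L, by omega⟩ ⟨0, by omega⟩ x (Fin.ext (by simpa using hk)) (by simpa using hx1)
      (by simpa [hL.trans_lt'] using hx2)]
    have e1 : L - (L - 1) = 1 := by omega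
    simp [e1, hLr]
  · intro x hx1 hx2
    obtain ⟨k, hk1, hk2⟩ := exists_nat_mul_le_lt hβ (sub_nonneg.mpr hx1)
    have hkL : k + 1 < L := by
      have : ((k : ℝ) + 1) * β < L * β := by linarith
      have := lt_of_mul_lt_mul_right this hβ.le
      exact_mod_cast this
    have hk := (hρ hS ⟨k, by omega⟩).1 (by simp only; omega)
    have e1 : min (k + 1) L = k + 1 := by omega
    have e2 : k + 1 - L = 0 := by omega
    have e3 : min k (L - 1) = k := by omega
    have e4 : k - (L - 1) = 0 := by omega
    rw [key ⟨k, by omega⟩ ⟨k + 1, by omega⟩ x (Fin.ext (by simpa using hk))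
      (by simp only [e1, e2]; push_cast; linarith)
      (by simp only [e1, e2, hkL, if_true]; push_cast; linarith)]
    simp only [e1, e2, e3, e4, show ¬ L < k by omega, if_false]
    push_cast; ring
  · intro x hx1 hx2
    obtain ⟨i, hi1, hi2⟩ := exists_nat_mul_le_lt hβ2 (sub_nonneg.mpr hx1)
    have hiS : i + 1 < S := by
      have : ((i : ℝ) + 1) * β ^ 2 < S * β ^ 2 := by linarith
      have := lt_of_mul_lt_mul_right this hβ2.le
      exact_mod_cast this
    have hk := (hρ hS ⟨L + i + 1, by omega⟩).2.2.2 (by simp only; omega)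
    have e1 : min (L + i) L = L := by omega
    have e2 : L + i - L = i := by omega
    have e3 : min (L + i + 1) (L - 1) = L - 1 := by omega
    have e4 : L + i + 1 - (L - 1) = i + 2 := by omega
    rw [key ⟨L + i + 1, by omega⟩ ⟨L + i, by omega⟩ x (Fin.ext (by simp only at hk ⊢; omega))
      (by simp only [e1, e2]; linarith)
      (by simp only [e1, e2, show ¬ L + i < L by omega, if_false]; linarith)]
    simp only [e1, e2, e3, e4, hLr, show L < L + i + 1 by omega, if_true]
    push_cast; ring
  · intro x hx1 hx2
    have hk := (hρ hS ⟨L - 1, by omega⟩).2.1 (by simp only; omega)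
    have e1 : min (L + S - 1) L = L := by omega
    have e2 : L + S - 1 - L = S - 1 := by omega
    have e3 : L - 1 - (L - 1) = 0 := by omega
    have hSr : ((S - 1 : ℕ) : ℝ) = S - 1 := by rw [Nat.cast_sub hS, Nat.cast_one]
    rw [key ⟨L - 1, by omega⟩ ⟨L + S - 1, by omega⟩ x (Fin.ext (by simp only; omega))
      (by simp only [e1, e2, hSr]; linarith)
      (by simp only [e1, e2, hSr, show ¬ L + S - 1 < L by omega, if_false]; linarith)]
    simp only [e1, e2, e3, hSr, hLr, show ¬ L < L - 1 by omega, if_false, min_self]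
    push_cast
    linarith

/-! ### Functions with logarithmic deviation over a rotation -/

/-- The Birkhoff sums of `h` over the rotation by `β` of the circle, represented by `[0, 1)`,
stay within `C log (1 + m)` of `m μ`, uniformly in the starting point. -/
def HasLogDeviation (β : ℝ) (h : ℝ → ℝ) (μ C : ℝ) : Prop :=
  ∀ (m : ℕ) (u : ℝ),
    |∑ j ∈ Finset.range m, h (Int.fract (u + j * β)) - m * μ| ≤ C * Real.log (1 + m)

namespace HasLogDeviation

variable {β : ℝ}

theorem const (β c : ℝ) : HasLogDeviation β (fun _ => c) c 0 := by
  intro m u; simp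

theorem add {h g : ℝ → ℝ} {μ ν C D : ℝ} (hh : HasLogDeviation β h μ C)
    (hg : HasLogDeviation β g ν D) :
    HasLogDeviation β (fun v => h v + g v) (μ + ν) (C + D) := by
  intro m u
  rw [Finset.sum_add_distrib, add_mul]
  refine le_trans (le_of_eq ?_) ((abs_add_le _ _).trans (add_le_add (hh m u) (hg m u)))
  congr 1; ring

theorem const_mul {h : ℝ → ℝ} {μ C : ℝ} (c : ℝ) (hh : HasLogDeviation β h μ C) :
    HasLogDeviation β (fun v => c * h v) (c * μ) (|c| * C) := by
  intro m u
  rw [← Finset.mul_sum, mul_left_comm, ← mul_sub, abs_mul, mul_assoc]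
  exact mul_le_mul_of_nonneg_left (hh m u) (abs_nonneg c)

theorem sub {h g : ℝ → ℝ} {μ ν C D : ℝ} (hh : HasLogDeviation β h μ C)
    (hg : HasLogDeviation β g ν D) :
    HasLogDeviation β (fun v => h v - g v) (μ - ν) (C + D) := by
  intro m u
  rw [Finset.sum_sub_distrib, add_mul]
  refine le_trans (le_of_eq ?_) ((abs_sub _ _).trans (add_le_add (hh m u) (hg m u)))
  congr 1; ring

theorem sum {h : ℕ → ℝ → ℝ} {μ : ℕ → ℝ} {C : ℝ} (n : ℕ)
    (hh : ∀ i, HasLogDeviation β (h i) (μ i) C) :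
    HasLogDeviation β (fun v => ∑ i ∈ Finset.range n, h i v) (∑ i ∈ Finset.range n, μ i)
      (n * C) := by
  induction n with
  | zero => simpa using const β 0
  | succ n ih =>
    simp only [Finset.sum_range_succ]
    have := ih.add (hh n)
    rwa [show ((n + 1 : ℕ) : ℝ) * C = n * C + C by push_cast; ring]

end HasLogDeviation

/-- Here `t` is any real number: the part of `[0, 1)` below `t` has length `max 0 (min t 1)`. -/
theorem exists_hasLogDeviation_ite_lt (L S : ℕ) (β : ℝ) (hβ : 0 < β)
    (hβ1 : (L : ℝ) * β + (S : ℝ) * β ^ 2 = 1) (hirr : Irrational β) :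
    ∃ K : ℝ, 0 ≤ K ∧ ∀ t : ℝ,
      HasLogDeviation β (fun v => if v < t then (1 : ℝ) else 0) (max 0 (min t 1)) K := by
  obtain ⟨K, hK, h⟩ := exists_rotation_discrepancy_le L S β hβ hβ1 hirr
  refine ⟨K, hK, fun t m u => ?_⟩
  refine le_trans (le_of_eq ?_) (h m u (max 0 (min t 1)) (le_max_left _ _)
    (max_le zero_le_one (min_le_right _ _)))
  congr 2
  refine Finset.sum_congr rfl fun j _ => ?_
  have h1 := Int.fract_nonneg (u + j * β)
  have h2 := Int.fract_lt_one (u + j * β)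
  refine if_congr ?_ rfl rfl
  simp only [lt_max_iff, lt_min_iff]
  constructor
  · intro h3; exact Or.inr ⟨h3, h2⟩
  · rintro (h3 | h3)
    · linarith
    · exact h3.1

/-! ### The tower over the interval `I_L` -/

/-- The point of `I_L` with relative position `u ∈ [0, 1)`. -/
noncomputable def basePoint (L : ℕ) (β u : ℝ) : ℝ := (L - 1 : ℝ) * β + β * u

/-- The return time to `I_L` of its point with relative position `u`. -/
noncomputable def returnTime (L S : ℕ) (β u : ℝ) : ℕ := if u < 1 - β then L else L + S

namespace IsLSExchange

variable {L S : ℕ} {β : ℝ} {f : ℝ → ℝ}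

/-- The orbit of a point of `I_L` descends through `I_{L-1}, …, I_1`. -/
theorem iterate_basePoint (hf : IsLSExchange L S β f) (hβ : 0 < β) {u : ℝ} (h0 : 0 ≤ u)
    (h1 : u < 1) (i : ℕ) (hi : i < L) :
    f^[i] (basePoint L β u) = (L - 1 - i : ℝ) * β + β * u := by
  induction i with
  | zero => simp [basePoint]
  | succ i ih =>
    have hi' : (i : ℝ) + 1 + 1 ≤ L := by exact_mod_cast hi
    rw [Function.iterate_succ_apply', ih (by omega), hf.long]
    · push_cast; ring
    · nlinarith [mul_nonneg hβ.le h0]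
    · nlinarith [mul_pos hβ (sub_pos.mpr h1), mul_nonneg hβ.le (Nat.cast_nonneg (α := ℝ) i)]

theorem iterate_basePoint_L (hf : IsLSExchange L S β f) (hL : 1 ≤ L) (hβ : 0 < β) {u : ℝ}
    (h0 : 0 ≤ u) (h1 : u < 1) : f^[L] (basePoint L β u) = basePoint L β (u + β) := by
  obtain ⟨l, rfl⟩ : ∃ l, L = l + 1 := ⟨L - 1, by omega⟩
  rw [Function.iterate_succ_apply', hf.iterate_basePoint hβ h0 h1 l (by omega), hf.first]
  · unfold basePoint; push_cast; ring
  · push_cast; nlinarith [mul_nonneg hβ.le h0]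
  · push_cast; nlinarith [mul_pos hβ (sub_pos.mpr h1)]

/-- The orbit of a point of the right part of `I_L` continues through `I_{L+1}, …, I_{L+S}`. -/
theorem iterate_basePoint_L_add (hf : IsLSExchange L S β f) (hL : 1 ≤ L) (hβ : 0 < β)
    (hβ1 : (L : ℝ) * β + (S : ℝ) * β ^ 2 = 1) {u : ℝ} (h0 : 0 ≤ u) (h1 : u < 1)
    (hu : 1 - β ≤ u) (i : ℕ) (hi : i < S) :
    f^[L + i] (basePoint L β u) = L * β + i * β ^ 2 + β * (u + β - 1) := by
  have hb2 : 0 < β ^ 2 := by positivity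
  induction i with
  | zero =>
    rw [add_zero, hf.iterate_basePoint_L hL hβ h0 h1]
    unfold basePoint; push_cast; ring
  | succ i ih =>
    have hi' : (i : ℝ) + 1 + 1 ≤ S := by exact_mod_cast hi
    rw [← add_assoc, Function.iterate_succ_apply', ih (by omega), hf.short]
    · push_cast; ring
    · nlinarith [mul_nonneg hβ.le (sub_nonneg.mpr hu),
        mul_nonneg hb2.le (Nat.cast_nonneg (α := ℝ) i)]
    · nlinarith [mul_pos hβ (sub_pos.mpr h1), mul_le_mul_of_nonneg_right hi' hb2.le]

/-- The first return map to `I_L` is, in relative positions, the rotation by `β`. -/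
theorem iterate_returnTime (hf : IsLSExchange L S β f) (hL : 1 ≤ L) (hS : 1 ≤ S) (hβ : 0 < β)
    (hβ1 : (L : ℝ) * β + (S : ℝ) * β ^ 2 = 1) (hβlt : β < 1) {u : ℝ} (h0 : 0 ≤ u) (h1 : u < 1) :
    f^[returnTime L S β u] (basePoint L β u) = basePoint L β (Int.fract (u + β)) := by
  have hb2 : 0 < β ^ 2 := by positivity
  unfold returnTime
  split_ifs with h
  · rw [hf.iterate_basePoint_L hL hβ h0 h1, Int.fract_eq_self.mpr ⟨by linarith, by linarith⟩]
  · push Not at h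
    have hfr : Int.fract (u + β) = u + β - 1 := by
      rw [Int.fract_eq_iff]
      exact ⟨by linarith, by linarith, 1, by push_cast; ring⟩
    obtain ⟨s, rfl⟩ : ∃ s, S = s + 1 := ⟨S - 1, by omega⟩
    push_cast at hβ1
    rw [← add_assoc, Function.iterate_succ_apply',
      hf.iterate_basePoint_L_add hL hβ (by push_cast; exact hβ1) h0 h1 h s (by omega), hf.last,
      hfr]
    · unfold basePoint; linear_combination hβ1
    · nlinarith [mul_nonneg hβ.le (sub_nonneg.mpr h)]
    · nlinarith [mul_pos hβ (sub_pos.mpr h1)]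

/-- Every point of `[0, 1)` lies in the tower over `I_L`. -/
theorem exists_iterate_basePoint_eq (hf : IsLSExchange L S β f) (hL : 1 ≤ L) (hβ : 0 < β)
    (hβ1 : (L : ℝ) * β + (S : ℝ) * β ^ 2 = 1) (hβlt : β < 1) {x : ℝ} (h0 : 0 ≤ x) (h1 : x < 1) :
    ∃ (s : ℕ) (u : ℝ), s ≤ L + S ∧ 0 ≤ u ∧ u < 1 ∧ f^[s] (basePoint L β u) = x := by
  have hb2 : 0 < β ^ 2 := by positivity
  rcases lt_or_ge x (L * β) with hx | hx
  · obtain ⟨k, hk1, hk2⟩ := exists_nat_mul_le_lt hβ h0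
    have hkL : k < L := by
      have := lt_of_mul_lt_mul_right (hk1.trans_lt hx) hβ.le
      exact_mod_cast this
    have hu0 : 0 ≤ x / β - k := by rw [sub_nonneg, le_div_iff₀ hβ]; exact hk1
    have hu1 : x / β - k < 1 := by
      rw [sub_lt_iff_lt_add, add_comm, div_lt_iff₀ hβ]; exact hk2
    refine ⟨L - 1 - k, x / β - k, by omega, hu0, hu1, ?_⟩
    rw [hf.iterate_basePoint hβ hu0 hu1 _ (by omega), Nat.cast_sub (by omega), Nat.cast_sub hL]
    field_simp
    push_cast; ring
  · obtain ⟨i, hi1, hi2⟩ := exists_nat_mul_le_lt hb2 (sub_nonneg.mpr hx)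
    have hiS : i < S := by
      have : (i : ℝ) * β ^ 2 < S * β ^ 2 := by linarith
      have := lt_of_mul_lt_mul_right this hb2.le
      exact_mod_cast this
    have hw0 : 0 ≤ (x - L * β - i * β ^ 2) / β := div_nonneg (by linarith) hβ.le
    have hw1 : (x - L * β - i * β ^ 2) / β < β := by rw [div_lt_iff₀ hβ]; nlinarith
    refine ⟨L + i, 1 - β + (x - L * β - i * β ^ 2) / β, by omega, by linarith, by linarith, ?_⟩
    rw [hf.iterate_basePoint_L_add hL hβ hβ1 (by linarith) (by linarith) (by linarith) i hiS]
    field_simp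
    ring

end IsLSExchange

/-! ### Deviations of the orbits -/

/-- The number of visits of the first `N` points of the orbit of `x` to `[0, a)`, minus the
expected number `N a`. -/
noncomputable def visitDeviation (f : ℝ → ℝ) (a : ℝ) (N : ℕ) (x : ℝ) : ℝ :=
  ∑ i ∈ Finset.range N, ((if 0 ≤ f^[i] x ∧ f^[i] x < a then (1 : ℝ) else 0) - a)

theorem visitDeviation_add (f : ℝ → ℝ) (a : ℝ) (M N : ℕ) (x : ℝ) :
    visitDeviation f a (M + N) x = visitDeviation f a M x + visitDeviation f a N (f^[M] x) := by
  unfold visitDeviation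
  rw [Finset.sum_range_add]
  simp only [← Function.iterate_add_apply, add_comm]

theorem abs_visitDeviation_le (f : ℝ → ℝ) {a : ℝ} (h0 : 0 ≤ a) (h1 : a ≤ 1) (N : ℕ) (x : ℝ) :
    |visitDeviation f a N x| ≤ N := by
  unfold visitDeviation
  refine (Finset.abs_sum_le_sum_abs _ _).trans ?_
  refine (Finset.sum_le_card_nsmul _ _ 1 fun i _ => ?_).trans (by simp)
  split_ifs <;> rw [abs_le] <;> constructor <;> linarith

/-- The lengths of the parts of `[k δ, (k + 1) δ)`, `k < n`, below `a` add up to that of the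
part of `[0, n δ)` below `a`. -/
theorem sum_clamp (n : ℕ) {δ : ℝ} (hδ : 0 ≤ δ) (a : ℝ) :
    ∑ k ∈ Finset.range n, max 0 (min (a - k * δ) δ) = max 0 (min a (n * δ)) := by
  induction n with
  | zero =>
    rcases le_total a 0 with h | h <;> simp [h]
  | succ n ih =>
    have hn : 0 ≤ n * δ := by positivity
    rw [Finset.sum_range_succ, ih]
    push_cast
    rw [add_mul, one_mul]
    rcases max_cases 0 (min a (n * δ)) with h | h <;>
    rcases min_cases a (n * δ) with h' | h' <;>
    rcases max_cases 0 (min (a - n * δ) δ) with h2 | h2 <;>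
    rcases min_cases (a - n * δ) δ with h3 | h3 <;>
    rcases max_cases 0 (min a (n * δ + δ)) with h4 | h4 <;>
    rcases min_cases a (n * δ + δ) with h5 | h5 <;> linarith

namespace IsLSExchange

variable {L S : ℕ} {β : ℝ} {f : ℝ → ℝ}

/-- The deviation over one passage through the tower, as a combination of indicators of
intervals in the base. -/
theorem visitDeviation_returnTime (hf : IsLSExchange L S β f) (hL : 1 ≤ L) (hβ : 0 < β)
    (hβ1 : (L : ℝ) * β + (S : ℝ) * β ^ 2 = 1) (a : ℝ) {u : ℝ} (h0 : 0 ≤ u) (h1 : u < 1) :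
    visitDeviation f a (returnTime L S β u) (basePoint L β u) =
      ∑ i ∈ Finset.range L, (if u < a / β - i then (1 : ℝ) else 0) +
      ∑ i ∈ Finset.range S,
        ((if u < max (1 - β) (1 - β + (a - L * β - i * β ^ 2) / β) then (1 : ℝ) else 0) -
          if u < 1 - β then (1 : ℝ) else 0) +
      ((S * a) * (if u < 1 - β then (1 : ℝ) else 0) - (L + S) * a) := by
  have hlow : visitDeviation f a L (basePoint L β u) =
      ∑ i ∈ Finset.range L, (if u < a / β - i then (1 : ℝ) else 0) - L * a := by
    unfold visitDeviation
    rw [Finset.sum_sub_distrib, Finset.sum_const, Finset.card_range, nsmul_eq_mul]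
    congr 1
    rw [← Finset.sum_range_reflect]
    refine Finset.sum_congr rfl fun i hi => ?_
    have hi := Finset.mem_range.mp hi
    rw [hf.iterate_basePoint hβ h0 h1 _ (by omega), Nat.cast_sub (by omega), Nat.cast_sub hL]
    refine if_congr ?_ rfl rfl
    rw [lt_sub_iff_add_lt, lt_div_iff₀ hβ]
    push_cast
    have e : ((L : ℝ) - 1 - (L - 1 - i)) * β + β * u = (u + i) * β := by ring
    rw [e]
    exact and_iff_right (by positivity)
  unfold returnTime
  split_ifs with h
  · have : ∀ i ∈ Finset.range S,
        ((if u < max (1 - β) (1 - β + (a - L * β - i * β ^ 2) / β) then (1 : ℝ) else 0) - 1)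
          = 0 := by
      intro i _
      rw [if_pos (lt_max_of_lt_left h), sub_self]
    rw [hlow, Finset.sum_eq_zero this]; ring
  · have hu : 1 - β ≤ u := not_lt.mp h
    rw [visitDeviation_add, hlow]
    have hhigh : visitDeviation f a S (f^[L] (basePoint L β u)) = ∑ i ∈ Finset.range S,
        ((if u < max (1 - β) (1 - β + (a - L * β - i * β ^ 2) / β) then (1 : ℝ) else 0) - 0)
          - S * a := by
      unfold visitDeviation
      rw [Finset.sum_sub_distrib, Finset.sum_const, Finset.card_range, nsmul_eq_mul]
      congr 1
      refine Finset.sum_congr rfl fun i hi => ?_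
      rw [← Function.iterate_add_apply, add_comm i L,
        hf.iterate_basePoint_L_add hL hβ hβ1 h0 h1 hu i (Finset.mem_range.mp hi), sub_zero]
      refine if_congr ?_ rfl rfl
      rw [lt_max_iff, or_iff_right h, ← sub_lt_iff_lt_add', lt_div_iff₀ hβ]
      have hpos : 0 ≤ β * (u + β - 1) := mul_nonneg hβ.le (by linarith)
      constructor
      · rintro ⟨_, h3⟩; linarith
      · intro h3; exact ⟨by positivity, by linarith⟩
    rw [hhigh]; ring

/-- The deviation over one passage through the tower has mean `0`: the parts of the levels below
`a` add up to `[0, a)`. -/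
theorem exists_hasLogDeviation (hf : IsLSExchange L S β f) (hL : 1 ≤ L) (hβ : 0 < β)
    (hβ1 : (L : ℝ) * β + (S : ℝ) * β ^ 2 = 1) (hβlt : β < 1) (hirr : Irrational β) :
    ∃ C : ℝ, 0 ≤ C ∧ ∀ (a : ℝ), 0 ≤ a → a ≤ 1 → ∀ (m : ℕ) (u : ℝ),
      |∑ j ∈ Finset.range m, visitDeviation f a (returnTime L S β (Int.fract (u + j * β)))
        (basePoint L β (Int.fract (u + j * β)))| ≤ C * Real.log (1 + m) := by
  obtain ⟨K, hK, hdev⟩ := exists_hasLogDeviation_ite_lt L S β hβ hβ1 hirr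
  refine ⟨L * K + S * (K + K) + (S * K + 0), by positivity, fun a h0 h1 m u => ?_⟩
  have hlog : 0 ≤ Real.log (1 + m) := Real.log_nonneg (by simp)
  have hb2 : 0 < β ^ 2 := by positivity
  have hD := ((HasLogDeviation.sum L fun i => hdev (a / β - i)).add
    (HasLogDeviation.sum S fun i => (hdev (max (1 - β) (1 - β + (a - L * β - i * β ^ 2) / β))).sub
      (hdev (1 - β)))).add
    (((hdev (1 - β)).const_mul (S * a)).sub (HasLogDeviation.const β ((L + S) * a)))
  have hclamp : max 0 (min (1 - β) 1) = 1 - β := by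
    rw [min_eq_left (by linarith), max_eq_right (by linarith)]
  have hmean : ∑ i ∈ Finset.range L, max 0 (min (a / β - i) 1) +
      ∑ i ∈ Finset.range S, (max 0 (min (max (1 - β) (1 - β + (a - L * β - i * β ^ 2) / β)) 1) -
        max 0 (min (1 - β) 1)) + (S * a * max 0 (min (1 - β) 1) - (L + S) * a) = 0 := by
    have e1 : ∀ i : ℕ, β * max 0 (min (a / β - i) 1) = max 0 (min (a - i * β) β) := by
      intro i
      rw [mul_max_of_nonneg _ _ hβ.le, mul_min_of_nonneg _ _ hβ.le, mul_zero, mul_one]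
      congr 2; field_simp
    have e2 : ∀ i : ℕ, β * (max 0 (min (max (1 - β) (1 - β + (a - L * β - i * β ^ 2) / β)) 1) -
        (1 - β)) = max 0 (min ((a - L * β) - i * β ^ 2) (β ^ 2)) := by
      intro i
      set y := (a - L * β - i * β ^ 2) / β with hy
      have hy' : a - L * β - i * β ^ 2 = β * y := by rw [hy]; field_simp
      have e3 : max 0 (min (max (1 - β) (1 - β + y)) 1) - (1 - β) = max 0 (min y β) := by
        rcases le_total y 0 with h | h
        · rw [max_eq_left (by linarith : 1 - β + y ≤ 1 - β), hclamp, min_eq_left (by linarith),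
            max_eq_left h, sub_self]
        · rw [max_eq_right (by linarith : 1 - β ≤ 1 - β + y)]
          rcases le_total y β with h' | h'
          · rw [min_eq_left (by linarith), min_eq_left h', max_eq_right h,
              max_eq_right (by linarith)]
            ring
          · rw [min_eq_right (by linarith), min_eq_right h', max_eq_right hβ.le,
              max_eq_right zero_le_one]
            ring
      rw [e3, hy', mul_max_of_nonneg _ _ hβ.le, mul_min_of_nonneg _ _ hβ.le, mul_zero, sq]
    rw [hclamp]
    apply mul_left_cancel₀ hβ.ne'
    rw [mul_add, mul_add, Finset.mul_sum, Finset.mul_sum, Finset.sum_congr rfl fun i _ => e1 i,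
      Finset.sum_congr rfl fun i _ => e2 i, sum_clamp L hβ.le, sum_clamp S hb2.le]
    have e4 : max 0 (min a (L * β)) + max 0 (min (a - L * β) (S * β ^ 2)) = a := by
      have hLβ : 0 ≤ L * β := by positivity
      rw [min_eq_left (by linarith : a - L * β ≤ S * β ^ 2)]
      rcases le_total a (L * β) with h | h
      · rw [min_eq_left h, max_eq_right h0, max_eq_left (by linarith), add_zero]
      · rw [min_eq_right h, max_eq_right hLβ, max_eq_right (by linarith)]; ring
    rw [e4]
    linear_combination (-a) * hβ1
  have hb := hD m u
  rw [hmean, mul_zero, sub_zero] at hb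
  rw [Finset.sum_congr rfl fun j _ => hf.visitDeviation_returnTime hL hβ hβ1 a
    (Int.fract_nonneg _) (Int.fract_lt_one _)]
  refine hb.trans (mul_le_mul_of_nonneg_right ?_ hlog)
  have hSa : |(S : ℝ) * a| ≤ S := by
    rw [abs_of_nonneg (by positivity)]
    exact mul_le_of_le_one_right (Nat.cast_nonneg S) h1
  gcongr

/-- An orbit segment starting in `I_L` consists of complete passages through the tower and a
rest of bounded length. -/
theorem exists_visitDeviation_basePoint (hf : IsLSExchange L S β f) (hL : 1 ≤ L) (hS : 1 ≤ S)
    (hβ : 0 < β) (hβ1 : (L : ℝ) * β + (S : ℝ) * β ^ 2 = 1) (hβlt : β < 1) {a : ℝ} (h0 : 0 ≤ a)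
    (h1 : a ≤ 1) (N : ℕ) : ∀ u : ℝ, ∃ m ≤ N,
      |visitDeviation f a N (basePoint L β (Int.fract u)) -
        ∑ j ∈ Finset.range m, visitDeviation f a (returnTime L S β (Int.fract (u + j * β)))
          (basePoint L β (Int.fract (u + j * β)))| ≤ L + S := by
  induction N using Nat.strong_induction_on with
  | _ N ih =>
  intro u
  have hr1 : 1 ≤ returnTime L S β (Int.fract u) := by unfold returnTime; split_ifs <;> omega
  have hr2 : returnTime L S β (Int.fract u) ≤ L + S := by unfold returnTime; split_ifs <;> omega
  rcases lt_or_ge N (returnTime L S β (Int.fract u)) with h | h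
  · refine ⟨0, Nat.zero_le _, ?_⟩
    rw [Finset.sum_range_zero, sub_zero]
    refine (abs_visitDeviation_le f h0 h1 _ _).trans ?_
    exact_mod_cast (h.trans_le hr2).le
  · obtain ⟨n, rfl⟩ := Nat.exists_eq_add_of_le h
    obtain ⟨m, hm, hb⟩ := ih n (by omega) (u + β)
    refine ⟨m + 1, by omega, ?_⟩
    have hfr : Int.fract (Int.fract u + β) = Int.fract (u + β) := by
      rw [Int.fract_eq_fract]
      exact ⟨-⌊u⌋, by rw [← Int.self_sub_floor]; push_cast; ring⟩
    rw [visitDeviation_add, hf.iterate_returnTime hL hS hβ hβ1 hβlt (Int.fract_nonneg _)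
      (Int.fract_lt_one _), hfr, Finset.sum_range_succ']
    have e : ∀ j : ℕ, u + ((j + 1 : ℕ) : ℝ) * β = u + β + j * β := by
      intro j; push_cast; ring
    simp only [e, Nat.cast_zero, zero_mul, add_zero]
    convert hb using 2
    ring

theorem exists_abs_visitDeviation_le (hf : IsLSExchange L S β f) (hL : 1 ≤ L) (hS : 1 ≤ S)
    (hβ : 0 < β) (hβ1 : (L : ℝ) * β + (S : ℝ) * β ^ 2 = 1) (hβlt : β < 1)
    (hirr : Irrational β) {x : ℝ} (hx0 : 0 ≤ x) (hx1 : x < 1) :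
    ∃ C : ℝ, 0 ≤ C ∧ ∀ (a : ℝ), 0 ≤ a → a ≤ 1 → ∀ N : ℕ, 3 ≤ N →
      |visitDeviation f a N x| ≤ C * Real.log N := by
  obtain ⟨C, hC, hdev⟩ := hf.exists_hasLogDeviation hL hβ hβ1 hβlt hirr
  obtain ⟨s, u, hs, hu0, hu1, rfl⟩ := hf.exists_iterate_basePoint_eq hL hβ hβ1 hβlt hx0 hx1
  have hA : 0 ≤ Real.log (2 + L + S) := Real.log_nonneg (by
    have : (0 : ℝ) ≤ L + S := by positivity
    linarith)
  refine ⟨C + (C * Real.log (2 + L + S) + 2 * (L + S)), by positivity, fun a h0 h1 N hN => ?_⟩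
  have hN3 : (3 : ℝ) ≤ N := by exact_mod_cast hN
  have hlogN : 1 ≤ Real.log N := by
    rw [Real.le_log_iff_exp_le (by linarith)]
    exact (Real.exp_one_lt_d9.le.trans (by norm_num)).trans hN3
  obtain ⟨m, hm, hb⟩ := hf.exists_visitDeviation_basePoint hL hS hβ hβ1 hβlt h0 h1 (s + N) u
  rw [Int.fract_eq_self.mpr ⟨hu0, hu1⟩, visitDeviation_add] at hb
  have hd := hdev a h0 h1 m u
  have hsd := abs_visitDeviation_le f h0 h1 s (basePoint L β u)
  have hsr : (s : ℝ) ≤ L + S := by exact_mod_cast hs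
  have hmr : (m : ℝ) ≤ L + S + N := by exact_mod_cast hm.trans (by omega)
  have hlog : Real.log (1 + m) ≤ Real.log (2 + L + S) + Real.log N := by
    rw [← Real.log_mul (by positivity) (by positivity)]
    apply Real.log_le_log (by positivity)
    have : (0 : ℝ) ≤ (L + S) * (N - 1) := mul_nonneg (by positivity) (by linarith)
    linarith
  have hCl := mul_le_mul_of_nonneg_left hlog hC
  have hrest : C * Real.log (2 + L + S) + 2 * (L + S) ≤
      (C * Real.log (2 + L + S) + 2 * (L + S)) * Real.log N :=
    le_mul_of_one_le_right (by positivity) hlogN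
  rw [abs_le] at hb hd hsd ⊢
  constructor <;> linarith [hb.1, hb.2, hd.1, hd.2, hsd.1, hsd.2]

end IsLSExchange

/-! ### Rational lengths -/

theorem bddAbove_range_starDiscrepancy (x : ℕ → ℝ) (N : ℕ) :
    BddAbove (Set.range fun a : Set.Icc (0 : ℝ) 1 =>
      |(((Finset.range N).filter (fun i => 0 ≤ x i ∧ x i < (a : ℝ))).card : ℝ) / (N : ℝ) -
        (a : ℝ)|) := by
  refine ⟨1, ?_⟩
  rintro _ ⟨⟨a, ha0, ha1⟩, rfl⟩
  have h1 : (((Finset.range N).filter (fun i => 0 ≤ x i ∧ x i < a)).card : ℝ) / N ≤ 1 := by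
    apply div_le_one_of_le₀ _ (Nat.cast_nonneg N)
    exact_mod_cast (Finset.card_filter_le _ _).trans (Finset.card_range N).le
  have h0 : 0 ≤ (((Finset.range N).filter (fun i => 0 ≤ x i ∧ x i < a)).card : ℝ) / N := by
    positivity
  simp only
  rw [abs_le]; constructor <;> linarith

/-- A sequence with values in a lattice `δ ℤ` misses `(0, δ)`, so that its discrepancy is bounded
away from `0`. -/
theorem le_starDiscrepancy_of_lattice {δ : ℝ} (hδ0 : 0 < δ) (hδ1 : δ ≤ 1) (x : ℕ → ℝ)
    (hx : ∀ i, ∃ z : ℤ, x i = z * δ) (N : ℕ) : δ / 4 ≤ starDiscrepancy x N := by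
  -- `[0, δ)` and `[0, δ / 2)` contain the same points, but differ in length by `δ / 2`.
  have h1 := le_ciSup (bddAbove_range_starDiscrepancy x N) ⟨δ, hδ0.le, hδ1⟩
  have h2 := le_ciSup (bddAbove_range_starDiscrepancy x N) ⟨δ / 2, by linarith, by linarith⟩
  have h3 : (Finset.range N).filter (fun i => 0 ≤ x i ∧ x i < δ) =
      (Finset.range N).filter (fun i => 0 ≤ x i ∧ x i < δ / 2) := by
    refine Finset.filter_congr fun i _ => and_congr_right fun _ => ⟨fun h => ?_, fun h => ?_⟩
    · obtain ⟨z, hz⟩ := hx i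
      have : z < 1 := by
        have : (z : ℝ) * δ < 1 * δ := by linarith
        exact_mod_cast lt_of_mul_lt_mul_right this hδ0.le
      have hz0 : (z : ℝ) ≤ 0 := by exact_mod_cast Int.lt_add_one_iff.mp this
      have := mul_nonpos_of_nonpos_of_nonneg hz0 hδ0.le
      linarith
    · linarith
  change _ ≤ starDiscrepancy x N at h1 h2
  simp only [h3] at h1 h2
  have := (abs_le.mp h1).1
  have := (abs_le.mp h2).2
  linarith

theorem not_isLowDiscrepancy_of_lattice {δ : ℝ} (hδ0 : 0 < δ) (hδ1 : δ ≤ 1) (x : ℕ → ℝ)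
    (hx : ∀ i, ∃ z : ℤ, x i = z * δ) : ¬ IsLowDiscrepancy x := by
  intro h
  have h1 : Filter.Tendsto (fun N : ℕ => (N : ℝ)⁻¹ * Real.log N) Filter.atTop (nhds 0) := by
    have := (Real.isLittleO_log_id_atTop.tendsto_div_nhds_zero).comp
      (tendsto_natCast_atTop_atTop (R := ℝ))
    refine this.congr fun N => ?_
    simp [div_eq_inv_mul]
  have h2 := ge_of_tendsto' (h.trans_tendsto h1) (le_starDiscrepancy_of_lattice hδ0 hδ1 x hx)
  linarith

/-- If all lengths lie in `δ ℤ`, an interval exchange maps `δ ℤ` to itself. -/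
theorem iet_mem_zmultiples {n : ℕ} {lam : Fin n → ℝ} (ρ : Equiv.Perm (Fin n)) {δ : ℝ}
    (h : ∀ i, lam i ∈ AddSubgroup.zmultiples δ) {x : ℝ} (hx : x ∈ AddSubgroup.zmultiples δ) :
    iet lam ρ x ∈ AddSubgroup.zmultiples δ := by
  unfold iet
  refine AddSubgroup.sum_mem _ fun i _ => ?_
  by_cases hi : x ∈ Set.Ico (ietLeft lam i) (ietLeft lam i + lam i)
  · rw [Set.indicator_of_mem hi]
    exact add_mem hx (sub_mem (AddSubgroup.sum_mem _ fun j _ => h j)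
      (AddSubgroup.sum_mem _ fun j _ => h j))
  · rw [Set.indicator_of_notMem hi]
    exact zero_mem _

theorem exists_lsLength_mem_zmultiples (L S : ℕ) (r : ℚ) :
    ∃ δ : ℝ, 0 < δ ∧ δ ≤ 1 ∧ ∀ i, lsLength L S r i ∈ AddSubgroup.zmultiples δ := by
  have hd : (1 : ℝ) ≤ r.den := by exact_mod_cast r.den_pos
  have hd0 : (r.den : ℝ) ≠ 0 := by positivity
  have hr : (r : ℝ) = (r.num : ℝ) / r.den := by exact_mod_cast (Rat.num_div_den r).symm
  refine ⟨1 / (r.den : ℝ) ^ 2, by positivity, ?_, fun i => ?_⟩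
  · rw [div_le_one (by positivity)]; exact one_le_pow₀ hd
  · rw [AddSubgroup.mem_zmultiples_iff]
    unfold lsLength
    split_ifs
    · refine ⟨r.num * r.den, ?_⟩
      rw [zsmul_eq_mul, hr]; push_cast; field_simp
    · refine ⟨r.num ^ 2, ?_⟩
      rw [zsmul_eq_mul, hr]; push_cast; field_simp

/-! ### Low discrepancy -/

theorem IsLSExchange.isLowDiscrepancy {L S : ℕ} {β : ℝ} {f : ℝ → ℝ} (hf : IsLSExchange L S β f)
    (hL : 1 ≤ L) (hS : 1 ≤ S) (hβ : 0 < β) (hβ1 : (L : ℝ) * β + (S : ℝ) * β ^ 2 = 1)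
    (hβlt : β < 1) (hirr : Irrational β) {x : ℝ} (hx : x ∈ Set.Ico (0 : ℝ) 1) :
    IsLowDiscrepancy (fun i : ℕ => f^[i] x) := by
  obtain ⟨C, hC, h⟩ := hf.exists_abs_visitDeviation_le hL hS hβ hβ1 hβlt hirr hx.1 hx.2
  refine Asymptotics.IsBigO.of_bound C ?_
  filter_upwards [Filter.eventually_ge_atTop 3] with N hN
  have hN0 : (0 : ℝ) < N := by exact_mod_cast (by omega : 0 < N)
  have hbound : ∀ a : Set.Icc (0 : ℝ) 1,
      |(((Finset.range N).filter (fun i => 0 ≤ f^[i] x ∧ f^[i] x < (a : ℝ))).card : ℝ) / N - a|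
        ≤ C * ((N : ℝ)⁻¹ * Real.log N) := by
    rintro ⟨a, ha0, ha1⟩
    have h1 := h a ha0 ha1 N hN
    unfold visitDeviation at h1
    rw [Finset.sum_sub_distrib, Finset.sum_boole, Finset.sum_const, Finset.card_range,
      nsmul_eq_mul] at h1
    have e : ∀ c : ℝ, c / N - a = (N : ℝ)⁻¹ * (c - N * a) := by
      intro c; field_simp
    rw [e, abs_mul, abs_of_pos (inv_pos.mpr hN0), mul_left_comm]
    exact mul_le_mul_of_nonneg_left h1 (inv_pos.mpr hN0).le
  have hlog : 0 ≤ Real.log N := Real.log_nonneg (by exact_mod_cast (by omega : 1 ≤ N))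
  have : Nonempty (Set.Icc (0 : ℝ) 1) := ⟨⟨0, by simp⟩⟩
  have h0 : 0 ≤ starDiscrepancy (fun i : ℕ => f^[i] x) N := Real.iSup_nonneg fun _ => abs_nonneg _
  rw [Real.norm_of_nonneg h0, Real.norm_of_nonneg (by positivity)]
  exact ciSup_le hbound

theorem mainTheorem4 (L S : ℕ) (hL : 1 ≤ L) (β : ℝ) (hβ : 0 < β)
    (hβ1 : (L : ℝ) * β + (S : ℝ) * β ^ 2 = 1)
    (ρ : Equiv.Perm (Fin (L + S))) (hρ : IsLSPerm L S ρ) :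
    (∀ x₀ ∈ Set.Ico (0 : ℝ) 1,
        IsLowDiscrepancy (fun i : ℕ => (iet (lsLength L S β) ρ)^[i] x₀)) ↔
      Irrational β := by
  constructor
  · rintro h ⟨r, rfl⟩
    obtain ⟨δ, hδ0, hδ1, hδ⟩ := exists_lsLength_mem_zmultiples L S r
    refine not_isLowDiscrepancy_of_lattice hδ0 hδ1 _ (fun i => ?_) (h 0 (by simp))
    have hmem : (iet (lsLength L S r) ρ)^[i] 0 ∈ AddSubgroup.zmultiples δ := by
      induction i with
      | zero => exact zero_mem _
      | succ i ih => rw [Function.iterate_succ_apply']; exact iet_mem_zmultiples ρ hδ ih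
    obtain ⟨z, hz⟩ := AddSubgroup.mem_zmultiples_iff.mp hmem
    exact ⟨z, by rw [← hz, zsmul_eq_mul]⟩
  · intro hirr x₀ hx₀
    have hLr : (1 : ℝ) ≤ L := by exact_mod_cast hL
    have hS : 1 ≤ S := by
      by_contra hS
      obtain rfl : S = 0 := by omega
      refine hirr ⟨1 / L, ?_⟩
      push_cast
      rw [div_eq_iff (by positivity)]
      linarith [hβ1, show ((0 : ℕ) : ℝ) * β ^ 2 = 0 by simp]
    have hSr : (1 : ℝ) ≤ S := by exact_mod_cast hS
    have hβlt : β < 1 := by nlinarith [sq_pos_of_pos hβ]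
    exact (isLSExchange_iet hL hS hβ hβ1 hρ).isLowDiscrepancy hL hS hβ hβ1 hβlt hirr hx₀
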